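/- Let $\mathbb O=\mathbb H\oplus\mathbb H$ be the octonions with the product $(q_1,q_2)(p_1,p_2)=(q_1p_1-\overline{p_2}q_2,\;p_2q_1+q_2\overline{p_1})$, conjugation $\overline{(q_1,q_2)}=(\overline{q_1},-q_2)$, inner product $\langle a,b\rangle=\mathrm{Re}(a\bar b)$, $|a|^2=\langle a,a\rangle$, and standard orthonormal basis $x_1,\dots,x_8$. Let $\mathbb OP^2=\mathcal U/\!\sim$, where $\mathcal U\subset\mathbb O^3$ is the set of triples with at least one entry equal to $1$, and $(a,b,c)\sim(a',b',c')$ iff $(a,b,c)=(a'\lambda,b'\lambda,c'\lambda)$ for some $\lambda\in\mathbb O\setminus\{0\}$. It is a smooth $16$-manifold with the three charts $[1,u,v]\mapsto(u,v)$, $[u,1,v]\mapsto(u,v)$, $[u,v,1]\mapsto(u,v)$, and it carries the Riemannian metric that is given in each of these charts by $$ds^2=\frac{|du|^2(1+|v|^2)+|dv|^2(1+|u|^2)-2\,\mathrm{Re}[(u\bar v)(dv\,d\bar u)]}{(1+|u|^2+|v|^2)^2}.$$ Let $P_0=[1,0,0]$, let $e_i=\partial_i$, $f_i=\partial_{i+8}$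 ($1\le i\le 8$) be the coordinate frame at $P_0$ of the chart $[1,u,v]\mapsto(u,v)$ (so $e_i$ corresponds to $(x_i,0)$ and $f_i$ to $(0,x_i)$), and let $R(X,Y,Z,W)=g(R(X,Y)Z,W)$ be the Riemann curvature tensor at $P_0$, with the sign convention $R(X,Y)Z=\nabla_Y\nabla_XZ-\nabla_X\nabla_YZ+\nabla_{[X,Y]}Z$. **Theorem.** For all $i,j,k,l\in\{1,\dots,8\}$: 1. if $i\neq j$, then $R(e_i,e_j,e_i,e_j)=-R(e_i,e_j,e_j,e_i)=4$; 2. if $i\neq j$, then $R(f_i,f_j,f_i,f_j)=-R(f_i,f_j,f_j,f_i)=4$; 3. $R(e_i,e_j,f_k,f_l)=R(f_k,f_l,e_i,e_j)=-\langle x_i\overline{x_l},x_j\overline{x_k}\rangle+\langle x_j\overline{x_l},x_i\overline{x_k}\rangle$; 4. $R(e_i,f_j,e_k,f_l)=R(f_i,e_j,f_k,e_l)=\langle x_i\overline{x_j},x_k\overline{x_l}\rangle$ and $R(e_i,f_j,f_l,e_k)=R(f_i,e_j,e_l,f_k)=-\langle x_i\overline{x_j},x_k\overline{x_l}\rangle$.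 All components of $R$ at $P_0$ in this frame that are not listed in 1–4 vanish. **Corollary.** If the pair $(a,b)=(\sum a_ix_i,\sum b_ix_i)\in\mathbb O^2$ is identified with the tangent vector $\sum a_ie_i+\sum b_if_i$ at $P_0$, then for all $a,b,c,d,e,f,g,h\in\mathbb O$ $$\begin{aligned}R\big((a,b),(c,d),(e,f),(g,h)\big)={}&4\langle a,e\rangle\langle c,g\rangle-4\langle c,e\rangle\langle a,g\rangle+4\langle b,f\rangle\langle d,h\rangle-4\langle d,f\rangle\langle b,h\rangle\\&-\langle e\bar d,g\bar b\rangle+\langle e\bar b,g\bar d\rangle-\langle c\bar f,a\bar h\rangle+\langle a\bar f,c\bar h\rangle-\langle a\bar d-c\bar b,\;g\bar f-e\bar h\rangle.\end{aligned}$$ -/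

import Mathlib

open scoped Quaternion

noncomputable section

/-! ### Octonions -/

/-- The octonions, as pairs of quaternions; the norm is the Euclidean one. -/
def Octonion : Type := WithLp 2 (ℍ[ℝ] × ℍ[ℝ])

namespace Octonion

instance : NormedAddCommGroup Octonion :=
  inferInstanceAs (NormedAddCommGroup (WithLp 2 (ℍ[ℝ] × ℍ[ℝ])))
instance : InnerProductSpace ℝ Octonion :=
  inferInstanceAs (InnerProductSpace ℝ (WithLp 2 (ℍ[ℝ] × ℍ[ℝ])))
instance : FiniteDimensional ℝ Octonion :=
  inferInstanceAs (FiniteDimensional ℝ (WithLp 2 (ℍ[ℝ] × ℍ[ℝ])))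

/-- The octonion `(p, q)`. -/
def mk (p q : ℍ[ℝ]) : Octonion := WithLp.toLp 2 (p, q)
/-- First quaternionic component. -/
def fst (a : Octonion) : ℍ[ℝ] := WithLp.fst a
/-- Second quaternionic component. -/
def snd (a : Octonion) : ℍ[ℝ] := WithLp.snd a

@[simp] theorem fst_mk (p q : ℍ[ℝ]) : (mk p q).fst = p := rfl
@[simp] theorem snd_mk (p q : ℍ[ℝ]) : (mk p q).snd = q := rfl
@[ext] theorem ext {a b : Octonion} (h₁ : a.fst = b.fst) (h₂ : a.snd = b.snd) : a = b :=
  congrArg (WithLp.toLp 2) (Prod.ext h₁ h₂)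
@[simp] theorem fst_add (a b : Octonion) : (a + b).fst = a.fst + b.fst := rfl
@[simp] theorem snd_add (a b : Octonion) : (a + b).snd = a.snd + b.snd := rfl
@[simp] theorem fst_zero : (0 : Octonion).fst = 0 := rfl
@[simp] theorem snd_zero : (0 : Octonion).snd = 0 := rfl
@[simp] theorem fst_neg (a : Octonion) : (-a).fst = -a.fst := rfl
@[simp] theorem snd_neg (a : Octonion) : (-a).snd = -a.snd := rfl
@[simp] theorem fst_sub (a b : Octonion) : (a - b).fst = a.fst - b.fst := rfl
@[simp] theorem snd_sub (a b : Octonion) : (a - b).snd = a.snd - b.snd := rfl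
@[simp] theorem fst_smul (r : ℝ) (a : Octonion) : (r • a).fst = r • a.fst := rfl
@[simp] theorem snd_smul (r : ℝ) (a : Octonion) : (r • a).snd = r • a.snd := rfl

/-- Cayley-Dickson multiplication. -/
instance : Mul Octonion :=
  ⟨fun a b => mk (a.fst * b.fst - star b.snd * a.snd) (b.snd * a.fst + a.snd * star b.fst)⟩
instance : One Octonion := ⟨mk 1 0⟩
/-- Octonionic conjugation. -/
instance : Star Octonion := ⟨fun a => mk (star a.fst) (-a.snd)⟩

@[simp] theorem fst_mul (a b : Octonion) :
    (a * b).fst = a.fst * b.fst - star b.snd * a.snd := rfl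
@[simp] theorem snd_mul (a b : Octonion) :
    (a * b).snd = b.snd * a.fst + a.snd * star b.fst := rfl
@[simp] theorem fst_one : (1 : Octonion).fst = 1 := rfl
@[simp] theorem snd_one : (1 : Octonion).snd = 0 := rfl
@[simp] theorem fst_star (a : Octonion) : (star a).fst = star a.fst := rfl
@[simp] theorem snd_star (a : Octonion) : (star a).snd = -a.snd := rfl

/-- The octonions form a (non-associative) unital ring. -/
instance : NonAssocRing Octonion :=
  { (inferInstance : AddCommGroup Octonion), (inferInstance : Mul Octonion),
    (inferInstance : One Octonion) with
    left_distrib := fun a b c => by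
      ext1 <;> simp only [fst_mul, snd_mul, fst_add, snd_add, star_add] <;> noncomm_ring
    right_distrib := fun a b c => by
      ext1 <;> simp only [fst_mul, snd_mul, fst_add, snd_add] <;> noncomm_ring
    zero_mul := fun a => by ext1 <;> simp
    mul_zero := fun a => by ext1 <;> simp
    one_mul := fun a => by ext1 <;> simp
    mul_one := fun a => by ext1 <;> simp }

instance : IsScalarTower ℝ Octonion Octonion :=
  ⟨fun r a b => by ext1 <;> simp [smul_sub, smul_add]⟩
instance : SMulCommClass ℝ Octonion Octonion :=
  ⟨fun r a b => by ext1 <;> simp [smul_sub, smul_add]⟩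

/-- Real part. -/
def re (a : Octonion) : ℝ := a.fst.re

/-- The inner product `<a, b> = Re (a b̄)`. -/
def ip (a b : Octonion) : ℝ := re (a * star b)

/-- The squared norm `|a|² = <a, a>`. -/
def normSq (a : Octonion) : ℝ := ip a a

/-- The inverse `a⁻¹ = |a|⁻² ā` (with `0⁻¹ = 0`). -/
instance : Inv Octonion := ⟨fun a => (normSq a)⁻¹ • star a⟩

theorem inv_def (a : Octonion) : a⁻¹ = (normSq a)⁻¹ • star a := rfl

/-- The eight real coordinates of an octonion. -/
def coords : Octonion ≃ₗ[ℝ] (Fin 8 → ℝ) where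
  toFun a := ![a.fst.re, a.fst.imI, a.fst.imJ, a.fst.imK,
    a.snd.re, a.snd.imI, a.snd.imJ, a.snd.imK]
  invFun c := mk ⟨c 0, c 1, c 2, c 3⟩ ⟨c 4, c 5, c 6, c 7⟩
  map_add' a b := by ext i; fin_cases i <;> simp
  map_smul' r a := by ext i; fin_cases i <;> simp
  left_inv a := by ext <;> rfl
  right_inv c := by ext i; fin_cases i <;> rfl

/-- The standard basis `x₁, …, x₈`, that is
`(1,0), (i,0), (j,0), (k,0), (0,1), (0,i), (0,j), (0,k)`. -/
def x : Module.Basis (Fin 8) ℝ Octonion := .ofEquivFun coords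

theorem ip_eq (a b : Octonion) : ip a b =
    a.fst.re * b.fst.re + a.fst.imI * b.fst.imI + a.fst.imJ * b.fst.imJ + a.fst.imK * b.fst.imK +
    a.snd.re * b.snd.re + a.snd.imI * b.snd.imI + a.snd.imJ * b.snd.imJ
      + a.snd.imK * b.snd.imK := by
  simp [ip, re]; ring

theorem ip_self (a : Octonion) : ip a a = ‖a‖ ^ 2 := by
  have h : ‖a‖ ^ 2 = ‖a.fst‖ ^ 2 + ‖a.snd‖ ^ 2 := WithLp.prod_norm_sq_eq_of_L2 a
  rw [h, ip_eq, sq ‖a.fst‖, sq ‖a.snd‖, ← Quaternion.normSq_eq_norm_mul_self,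
    ← Quaternion.normSq_eq_norm_mul_self, Quaternion.normSq_def', Quaternion.normSq_def']
  ring

theorem normSq_eq (a : Octonion) : normSq a = ‖a‖ ^ 2 := ip_self a

theorem normSq_ne_zero {a : Octonion} : normSq a ≠ 0 ↔ a ≠ 0 := by
  rw [normSq_eq]; simp

theorem normSq_mul (a b : Octonion) : normSq (a * b) = normSq a * normSq b := by
  simp only [normSq, ip_eq]; simp; ring

theorem star_mul' (a b : Octonion) : star (a * b) = star b * star a := by
  ext1 <;> simp [sub_eq_add_neg]

theorem mul_mul_star (a b : Octonion) : (a * b) * star b = normSq b • a := by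
  simp only [normSq, ip_eq]; ext <;> simp <;> ring

theorem star_mul_mul (a b : Octonion) : star b * (b * a) = normSq b • a := by
  simp only [normSq, ip_eq]; ext <;> simp <;> ring

theorem mul_star_mul (a b : Octonion) : b * (star b * a) = normSq b • a := by
  simp only [normSq, ip_eq]; ext <;> simp <;> ring

theorem ip_eq_inner (a b : Octonion) : ip a b = inner ℝ a b := by
  have h : inner ℝ a b = inner ℝ a.fst b.fst + inner ℝ a.snd b.snd :=
    WithLp.prod_inner_apply (𝕜 := ℝ) (E := ℍ[ℝ]) (F := ℍ[ℝ]) a b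
  rw [h, ip_eq, Quaternion.inner_def, Quaternion.inner_def]
  simp; ring

end Octonion

namespace Octonion

theorem normSq_one : normSq 1 = 1 := by simp [normSq, ip, re]

theorem mul_inv_cancel_right {b : Octonion} (hb : b ≠ 0) (a : Octonion) : (a * b) * b⁻¹ = a := by
  rw [inv_def, mul_smul_comm, mul_mul_star, smul_smul, inv_mul_cancel₀ (normSq_ne_zero.2 hb),
    one_smul]

theorem inv_mul_cancel_left {b : Octonion} (hb : b ≠ 0) (a : Octonion) : b⁻¹ * (b * a) = a := by
  rw [inv_def, smul_mul_assoc, star_mul_mul, smul_smul, inv_mul_cancel₀ (normSq_ne_zero.2 hb),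
    one_smul]

theorem mul_inv_cancel_left {b : Octonion} (hb : b ≠ 0) (a : Octonion) : b * (b⁻¹ * a) = a := by
  rw [inv_def, smul_mul_assoc, mul_smul_comm, mul_star_mul, smul_smul,
    inv_mul_cancel₀ (normSq_ne_zero.2 hb), one_smul]

theorem mul_inv_self {b : Octonion} (hb : b ≠ 0) : b * b⁻¹ = 1 := by
  simpa using mul_inv_cancel_right hb 1

theorem inv_zero' : (0 : Octonion)⁻¹ = 0 := by
  rw [inv_def]; simp [normSq, ip, re]

theorem inv_one' : (1 : Octonion)⁻¹ = 1 := by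
  rw [inv_def, normSq_one, inv_one, one_smul]; ext1 <;> simp

theorem mul_inv_rev' (a b : Octonion) : (a * b)⁻¹ = b⁻¹ * a⁻¹ := by
  rw [inv_def, inv_def, inv_def, normSq_mul, star_mul', smul_mul_smul_comm, mul_inv, mul_comm]

theorem mul_ne_zero' {a b : Octonion} (ha : a ≠ 0) (hb : b ≠ 0) : a * b ≠ 0 := by
  rw [← normSq_ne_zero, normSq_mul]
  exact mul_ne_zero (normSq_ne_zero.2 ha) (normSq_ne_zero.2 hb)

theorem one_ne_zero' : (1 : Octonion) ≠ 0 := by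
  rw [← normSq_ne_zero, normSq_one]; exact one_ne_zero

theorem inv_ne_zero' {a : Octonion} (ha : a ≠ 0) : a⁻¹ ≠ 0 := by
  intro h
  have := mul_inv_self ha
  rw [h, mul_zero] at this
  exact one_ne_zero' this.symm

theorem ne_zero_of_mul_eq_one {a b : Octonion} (h : a * b = 1) : a ≠ 0 := by
  rintro rfl
  rw [zero_mul] at h
  exact one_ne_zero' h.symm

theorem eq_inv_of_mul_eq_one {a b : Octonion} (h : a * b = 1) : b = a⁻¹ := by
  rw [← inv_mul_cancel_left (ne_zero_of_mul_eq_one h) b, h, mul_one]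

theorem inv_inv' (a : Octonion) : a⁻¹⁻¹ = a := by
  by_cases ha : a = 0
  · rw [ha, inv_zero', inv_zero']
  · have := mul_inv_cancel_left ha a⁻¹⁻¹
    rw [mul_inv_self (inv_ne_zero' ha), mul_one] at this
    exact this.symm

theorem contDiff_mul : ContDiff ℝ ⊤ fun p : Octonion × Octonion => p.1 * p.2 :=
  (LinearMap.mul ℝ Octonion).toContinuousBilinearMap.isBoundedBilinearMap.contDiff

instance : ContinuousMul Octonion := ⟨contDiff_mul.continuous⟩

/-- Conjugation as a linear map. -/
def starL : Octonion →ₗ[ℝ] Octonion where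
  toFun := star
  map_add' a b := by ext1 <;> simp; abel
  map_smul' r a := by ext1 <;> simp

theorem contDiff_star : ContDiff ℝ ⊤ fun a : Octonion => star a :=
  (LinearMap.toContinuousLinearMap starL).contDiff

theorem contDiffAt_inv {a : Octonion} (ha : a ≠ 0) :
    ContDiffAt ℝ ⊤ (fun a : Octonion => a⁻¹) a := by
  have h : ContDiffAt ℝ ⊤ (fun a : Octonion => (‖a‖ ^ 2)⁻¹) a :=
    (contDiff_norm_sq ℝ).contDiffAt.inv (by simpa using ha)
  refine (h.smul contDiff_star.contDiffAt).congr_of_eventuallyEq (.of_forall fun b => ?_)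
  simp [inv_def, normSq_eq]

end Octonion

/-! ### The octonionic projective plane -/

/-- The set `𝒰 = U₁ ∪ U₂ ∪ U₃ ⊆ 𝕆³` of triples with at least one entry equal to `1`. -/
abbrev ReducedTriple : Type := {p : Fin 3 → Octonion // ∃ i, p i = 1}

namespace ReducedTriple

/-- `p ~ q` iff `p = q l` for some non-zero octonion `l`. -/
def Rel (p q : ReducedTriple) : Prop :=
  ∃ l : Octonion, l ≠ 0 ∧ ∀ i, p.1 i = q.1 i * l

theorem Rel.ne_zero {p q : ReducedTriple} (h : Rel p q) {i : Fin 3} (hi : q.1 i ≠ 0) :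
    p.1 i ≠ 0 := by
  obtain ⟨l, hl, h⟩ := h
  rw [h]; exact Octonion.mul_ne_zero' hi hl

theorem Rel.symm {p q : ReducedTriple} (h : Rel p q) : Rel q p := by
  obtain ⟨l, hl, h⟩ := h
  exact ⟨l⁻¹, Octonion.inv_ne_zero' hl, fun i => by
    rw [h, Octonion.mul_inv_cancel_right hl]⟩

theorem Rel.ratio {p q : ReducedTriple} (h : Rel p q) (i j : Fin 3) :
    p.1 j * (p.1 i)⁻¹ = q.1 j * (q.1 i)⁻¹ := by
  by_cases hi : q.1 i = 0
  · obtain ⟨l, hl, h⟩ := h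
    rw [h i, hi, zero_mul, Octonion.inv_zero', mul_zero, mul_zero]
  have hpi := h.ne_zero hi
  obtain ⟨l, hl, h⟩ := h
  obtain ⟨m, hm⟩ := q.2
  obtain ⟨n, hn⟩ := p.2
  by_cases hij : i = j
  · rw [← hij, Octonion.mul_inv_self hi, Octonion.mul_inv_self hpi]
  rw [h n] at hn
  have hn' := Octonion.eq_inv_of_mul_eq_one hn
  rw [h i, h j]
  by_cases h1 : m = i
  · rw [← h1, hm, one_mul, Octonion.mul_inv_cancel_right hl, Octonion.inv_one', mul_one]
  by_cases h2 : m = j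
  · rw [← h2, hm, one_mul, one_mul, Octonion.mul_inv_rev', Octonion.mul_inv_cancel_left hl]
  by_cases h3 : n = i
  · rw [← h3, hn, Octonion.inv_one', mul_one, hn']
  by_cases h4 : n = j
  · rw [← h4, hn, one_mul, Octonion.mul_inv_rev', hn', Octonion.inv_inv']
  have h5 : m = n := by omega
  rw [← h5, hm, one_mul] at hn
  rw [hn, mul_one, mul_one]

theorem Rel.trans {p q r : ReducedTriple} (h₁ : Rel p q) (h₂ : Rel q r) : Rel p r := by
  obtain ⟨n, hn⟩ := p.2
  have hp : p.1 n ≠ 0 := by rw [hn]; exact Octonion.one_ne_zero'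
  refine ⟨(r.1 n)⁻¹, Octonion.inv_ne_zero' (h₂.symm.ne_zero (h₁.symm.ne_zero hp)), fun j => ?_⟩
  rw [← h₂.ratio, ← h₁.ratio, hn, Octonion.inv_one', mul_one]

/-- `~` is an equivalence relation on `𝒰`. -/
def setoid : Setoid ReducedTriple where
  r := Rel
  iseqv := ⟨fun _ => ⟨1, Octonion.one_ne_zero', fun _ => (mul_one _).symm⟩, .symm, .trans⟩

end ReducedTriple

/-- The octonionic projective plane `𝕆P² = 𝒰 / ~`, with the quotient topology. -/
def OP2 : Type := Quotient ReducedTriple.setoid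

namespace OP2

instance : TopologicalSpace OP2 := inferInstanceAs (TopologicalSpace (Quotient _))

/-- The class of a reduced triple. -/
def ofTriple (p : ReducedTriple) : OP2 := Quotient.mk _ p

/-- The chart domain `Uᵢ / ~`: the classes that have a representative with `i`-th entry `1`. -/
def U (i : Fin 3) : Set OP2 := {P | ∃ p : ReducedTriple, p.1 i = 1 ∧ ofTriple p = P}

/-- The class of the triple with `i`-th entry `1` and the other two entries `u`, `v`, in this order:
`[1,u,v]`, `[u,1,v]` or `[u,v,1]`. -/
def point (i : Fin 3) (w : Octonion × Octonion) : OP2 :=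
  ofTriple ⟨i.insertNth 1 ![w.1, w.2], i, by simp⟩

/-- The coordinates `(p_j p_i⁻¹, p_k p_i⁻¹)` of `[p]`, where `j < k` are the two indices other than
`i`. On a representative with `p_i = 1` these are the two other entries. -/
def coord (i : Fin 3) : OP2 → Octonion × Octonion :=
  Quotient.lift
    (fun p : ReducedTriple =>
      (p.1 (i.succAbove 0) * (p.1 i)⁻¹, p.1 (i.succAbove 1) * (p.1 i)⁻¹))
    (fun _ _ h => Prod.ext (ReducedTriple.Rel.ratio h _ _) (ReducedTriple.Rel.ratio h _ _))

theorem coord_ofTriple (i : Fin 3) (p : ReducedTriple) : coord i (ofTriple p) =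
    (p.1 (i.succAbove 0) * (p.1 i)⁻¹, p.1 (i.succAbove 1) * (p.1 i)⁻¹) := rfl

theorem point_mem (i : Fin 3) (w : Octonion × Octonion) : point i w ∈ U i :=
  ⟨_, by simp, rfl⟩

theorem coord_point (i : Fin 3) (w : Octonion × Octonion) : coord i (point i w) = w := by
  rw [point, coord_ofTriple]
  simp [Octonion.inv_one']

theorem point_coord {i : Fin 3} {P : OP2} (hP : P ∈ U i) : point i (coord i P) = P := by
  obtain ⟨p, hp, rfl⟩ := hP
  rw [coord_ofTriple, hp, Octonion.inv_one', mul_one, mul_one, point]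
  congr 1
  apply Subtype.ext
  funext j
  rcases Fin.eq_self_or_eq_succAbove i j with rfl | ⟨k, rfl⟩
  · simp [hp]
  · fin_cases k <;> simp

theorem ofTriple_mem {i : Fin 3} {p : ReducedTriple} : ofTriple p ∈ U i ↔ p.1 i ≠ 0 := by
  constructor
  · rintro ⟨q, hq, h⟩
    have h' : ReducedTriple.Rel q p := Quotient.exact h
    exact h'.symm.ne_zero (by rw [hq]; exact Octonion.one_ne_zero')
  · intro h
    obtain ⟨n, hn⟩ := p.2
    refine ⟨⟨fun j => p.1 j * (p.1 i)⁻¹, i, Octonion.mul_inv_self h⟩,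
      Octonion.mul_inv_self h, Quotient.sound ⟨(p.1 i)⁻¹, Octonion.inv_ne_zero' h, fun j => rfl⟩⟩

theorem continuous_ofTriple : Continuous ofTriple := continuous_quot_mk

theorem isOpen_U (i : Fin 3) : IsOpen (U i) := by
  have h : IsOpen (ofTriple ⁻¹' U i) := by
    have : ofTriple ⁻¹' U i = {p | p.1 i ≠ 0} := by ext p; exact ofTriple_mem
    rw [this]
    exact isOpen_ne.preimage ((continuous_apply i).comp continuous_subtype_val)
  exact h

theorem continuous_point (i : Fin 3) : Continuous (point i) := by
  refine continuous_ofTriple.comp (Continuous.subtype_mk ?_ _)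
  refine continuous_pi fun j => ?_
  rcases Fin.eq_self_or_eq_succAbove i j with rfl | ⟨k, rfl⟩
  · simpa using continuous_const
  · fin_cases k
    · simpa using continuous_fst
    · simpa using continuous_snd

theorem continuousOn_coord (i : Fin 3) : ContinuousOn (coord i) (U i) := by
  have hq : Topology.IsQuotientMap ofTriple := isQuotientMap_quot_mk
  rw [hq.continuousOn_isOpen_iff (isOpen_U i)]
  intro p hp
  have hp' : p.1 i ≠ 0 := ofTriple_mem.1 hp
  have hc : ∀ j, ContinuousAt (fun p : ReducedTriple => p.1 j) p := fun j =>
    ((continuous_apply j).comp continuous_subtype_val).continuousAt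
  have hi : ContinuousAt (fun p : ReducedTriple => (p.1 i)⁻¹) p :=
    ContinuousAt.comp (f := fun p : ReducedTriple => p.1 i)
      (g := fun a : Octonion => a⁻¹) (Octonion.contDiffAt_inv hp').continuousAt (hc i)
  exact (((hc _).mul hi).prodMk ((hc _).mul hi)).continuousWithinAt

/-- The chart `φᵢ : Uᵢ / ~ → 𝕆 × 𝕆`. -/
def chart (i : Fin 3) : OpenPartialHomeomorph OP2 (Octonion × Octonion) where
  toFun := coord i
  invFun := point i
  source := U i
  target := Set.univ
  map_source' _ _ := Set.mem_univ _
  map_target' w _ := point_mem i w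
  left_inv' _ hP := point_coord hP
  right_inv' w _ := coord_point i w
  open_source := isOpen_U i
  open_target := isOpen_univ
  continuousOn_toFun := continuousOn_coord i
  continuousOn_invFun := (continuous_point i).continuousOn

theorem exists_mem_U (P : OP2) : ∃ i, P ∈ U i := by
  obtain ⟨p, rfl⟩ := Quotient.exists_rep P
  obtain ⟨i, hi⟩ := p.2
  exact ⟨i, p, hi, rfl⟩

open Classical in
/-- The index of the first chart domain that contains the point. -/
def chartIndex (P : OP2) : Fin 3 := if P ∈ U 0 then 0 else if P ∈ U 1 then 1 else 2

theorem mem_U_chartIndex (P : OP2) : P ∈ U (chartIndex P) := by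
  unfold chartIndex
  split_ifs with h0 h1
  · exact h0
  · exact h1
  · obtain ⟨i, hi⟩ := exists_mem_U P
    fin_cases i
    · exact absurd hi h0
    · exact absurd hi h1
    · exact hi

/-- The atlas `{φ₁, φ₂, φ₃}`. -/
instance : ChartedSpace (Octonion × Octonion) OP2 where
  atlas := Set.range chart
  chartAt P := chart (chartIndex P)
  mem_chart_source := mem_U_chartIndex
  chart_mem_atlas _ := Set.mem_range_self _

open scoped Manifold ContDiff

/-- The entries of the triple with `i`-th entry `1` and the other two `u`, `v`. -/
def entry (i k : Fin 3) (w : Octonion × Octonion) : Octonion :=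
  (i.insertNth 1 ![w.1, w.2] : Fin 3 → Octonion) k

theorem contDiff_entry (i k : Fin 3) : ContDiff ℝ ∞ (entry i k) := by
  unfold entry
  rcases Fin.eq_self_or_eq_succAbove i k with rfl | ⟨k, rfl⟩
  · simp only [Fin.insertNth_apply_same]
    exact contDiff_const
  · simp only [Fin.insertNth_apply_succAbove]
    fin_cases k
    · exact contDiff_fst
    · exact contDiff_snd

theorem coord_point_eq (i j : Fin 3) (w : Octonion × Octonion) : coord j (point i w) =
    (entry i (j.succAbove 0) w * (entry i j w)⁻¹, entry i (j.succAbove 1) w * (entry i j w)⁻¹) :=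
  rfl

/-- The transition maps are smooth. -/
theorem contDiffAt_transition (i j : Fin 3) (w : Octonion × Octonion) (hw : point i w ∈ U j) :
    ContDiffAt ℝ ∞ (fun w => coord j (point i w)) w := by
  simp only [coord_point_eq]
  have hw' : entry i j w ≠ 0 := ofTriple_mem.1 hw
  have hinv : ContDiffAt ℝ ∞ (fun w => (entry i j w)⁻¹) w :=
    ((Octonion.contDiffAt_inv hw').of_le le_top).comp w (contDiff_entry i j).contDiffAt
  have hmul : ∀ k, ContDiffAt ℝ ∞ (fun w => entry i k w * (entry i j w)⁻¹) w := by
    intro k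
    have h1 := (contDiff_entry i k).contDiffAt (x := w)
    have h2 := h1.prodMk hinv
    have h3 : ContDiffAt ℝ ∞ (fun p : Octonion × Octonion => p.1 * p.2)
      (entry i k w, (entry i j w)⁻¹) := Octonion.contDiff_mul.contDiffAt.of_le le_top
    exact ContDiffAt.comp (f := fun w => (entry i k w, (entry i j w)⁻¹))
      (g := fun p : Octonion × Octonion => p.1 * p.2) w h3 h2
  exact ContDiffAt.prodMk (hmul (j.succAbove 0)) (hmul (j.succAbove 1))

instance : IsManifold 𝓘(ℝ, Octonion × Octonion) ∞ OP2 := by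
  refine isManifold_of_contDiffOn _ _ _ ?_
  rintro _ _ ⟨i, rfl⟩ ⟨j, rfl⟩ w hw
  exact (contDiffAt_transition i j w hw.1.2).contDiffWithinAt

end OP2

/-! ### The Riemann curvature tensor of a metric, in coordinates -/

namespace CoordinateCurvature

variable {E : Type*} [NormedAddCommGroup E] [NormedSpace ℝ E]
  {ι : Type*} [Fintype ι] [DecidableEq ι]

/-- The partial derivative `∂_α f`, with respect to the linear coordinates given by `b`. -/
def partialDeriv (b : Module.Basis ι ℝ E) (α : ι) (f : E → ℝ) (y : E) : ℝ :=
  fderiv ℝ f y (b α)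

/-- The matrix `g_{αβ}` of a field `G` of bilinear forms on `E`. -/
def gram (b : Module.Basis ι ℝ E) (G : E → E → E → ℝ) (y : E) : Matrix ι ι ℝ :=
  Matrix.of fun α β => G y (b α) (b β)

/-- The Christoffel symbol
`Γ_{αβ}^δ = 1/2 ∑_ε g^{δε} (∂_α g_{βε} + ∂_β g_{αε} - ∂_ε g_{αβ})`. -/
def christoffel (b : Module.Basis ι ℝ E) (G : E → E → E → ℝ) (δ α β : ι) (y : E) : ℝ :=
  (1 / 2) * ∑ ε, (gram b G y)⁻¹ δ ε *
    (partialDeriv b α (fun z => gram b G z β ε) y + partialDeriv b β (fun z => gram b G z α ε) y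
      - partialDeriv b ε (fun z => gram b G z α β) y)

/-- The components `R_{αβγ}^δ` of `R(X,Y)Z = ∇_Y ∇_X Z - ∇_X ∇_Y Z + ∇_{[X,Y]} Z`, that is
`R(∂_α,∂_β)∂_γ = ∑_δ R_{αβγ}^δ ∂_δ`. With this sign, `R(X,Y,X,Y) = g(R(X,Y)X,Y)` is positive on the
round sphere. -/
def riemannUp (b : Module.Basis ι ℝ E) (G : E → E → E → ℝ) (α β γ δ : ι) (y : E) : ℝ :=
  partialDeriv b β (christoffel b G δ α γ) y - partialDeriv b α (christoffel b G δ β γ) y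
    + ∑ ε, (christoffel b G ε α γ y * christoffel b G δ β ε y
      - christoffel b G ε β γ y * christoffel b G δ α ε y)

/-- The components `R_{αβγδ} = g(R(∂_α,∂_β)∂_γ, ∂_δ)`. -/
def riemannLow (b : Module.Basis ι ℝ E) (G : E → E → E → ℝ) (α β γ δ : ι) (y : E) : ℝ :=
  ∑ ε, riemannUp b G α β γ ε y * gram b G y ε δ

open scoped Manifold

variable {M : Type*} [TopologicalSpace M] [ChartedSpace E M]

/-- The expression of a Riemannian metric on `M` in the preferred chart at `P`, i.e. its pull-back
under the inverse of that chart. -/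
def metricInChart (g : Bundle.RiemannianMetric (fun Q : M => TangentSpace 𝓘(ℝ, E) Q)) (P : M)
    (y v w : E) : ℝ :=
  g.inner ((chartAt E P).symm y) (mfderiv 𝓘(ℝ, E) 𝓘(ℝ, E) (chartAt E P).symm y v)
    (mfderiv 𝓘(ℝ, E) 𝓘(ℝ, E) (chartAt E P).symm y w)

/-- The Riemann curvature tensor `R(X,Y,Z,W)` of `g` at `P`. The tangent space at `P` is identified
with `E` through the preferred chart at `P`, so the coefficients of `X` in the coordinate frame of
that chart are `b.repr X`. -/
def riemannTensor (b : Module.Basis ι ℝ E)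
    (g : Bundle.RiemannianMetric (fun Q : M => TangentSpace 𝓘(ℝ, E) Q)) (P : M)
    (X Y Z W : TangentSpace 𝓘(ℝ, E) P) : ℝ :=
  ∑ α, ∑ β, ∑ γ, ∑ δ, b.repr X α * b.repr Y β * b.repr Z γ * b.repr W δ *
    riemannLow b (metricInChart g P) α β γ δ (chartAt E P P)

end CoordinateCurvature

/-! ### The metric of the octonionic projective plane -/

namespace Octonion

theorem norm_mul' (a b : Octonion) : ‖a * b‖ = ‖a‖ * ‖b‖ := by
  have h := normSq_mul a b
  rw [normSq_eq, normSq_eq, normSq_eq, ← mul_pow] at h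
  exact (sq_eq_sq₀ (norm_nonneg _) (by positivity)).1 h

theorem star_star' (a : Octonion) : star (star a) = a := by
  ext1 <;> simp

theorem norm_star' (a : Octonion) : ‖star a‖ = ‖a‖ := by
  have h : ‖star a‖ ^ 2 = ‖a‖ ^ 2 := by
    rw [← ip_self, ← ip_self, ip_eq, ip_eq]; simp
  exact (sq_eq_sq₀ (norm_nonneg _) (norm_nonneg _)).1 h

theorem re_mul_le (a b : Octonion) : re (a * b) ≤ ‖a‖ * ‖b‖ := by
  have h : re (a * b) = inner ℝ a (star b) := by rw [← ip_eq_inner, ip, star_star']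
  rw [h, ← norm_star' b]
  exact real_inner_le_norm _ _

theorem star_add' (a b : Octonion) : star (a + b) = star a + star b := starL.map_add a b
theorem star_smul' (r : ℝ) (a : Octonion) : star (r • a) = r • star a := starL.map_smul r a
theorem re_add (a b : Octonion) : re (a + b) = re a + re b := rfl
theorem re_smul (r : ℝ) (a : Octonion) : re (r • a) = r * re a := rfl

end Octonion

namespace OP2

open Octonion

/-- The polarization of the quadratic form
`ds² = (|du|²(1+|v|²) + |dv|²(1+|u|²) - 2 Re[(u v̄)(dv dū)]) / (1+|u|²+|v|²)²`
at the point `w = (u, v)` of a chart. -/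
def metricForm (w s t : Octonion × Octonion) : ℝ :=
  (ip s.1 t.1 * (1 + normSq w.2) + ip s.2 t.2 * (1 + normSq w.1)
    - (re ((w.1 * star w.2) * (s.2 * star t.1)) + re ((w.1 * star w.2) * (t.2 * star s.1))))
    / (1 + normSq w.1 + normSq w.2) ^ 2

theorem metricForm_self (w s : Octonion × Octonion) : metricForm w s s =
    (normSq s.1 * (1 + normSq w.2) + normSq s.2 * (1 + normSq w.1)
      - 2 * re ((w.1 * star w.2) * (s.2 * star s.1))) / (1 + normSq w.1 + normSq w.2) ^ 2 := by
  simp only [metricForm, normSq]; ring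

theorem metricForm_comm (w s t : Octonion × Octonion) :
    metricForm w s t = metricForm w t s := by
  simp only [metricForm, ip_eq_inner, real_inner_comm]; ring

theorem metricForm_add (w s s' t : Octonion × Octonion) :
    metricForm w (s + s') t = metricForm w s t + metricForm w s' t := by
  simp only [metricForm, ip, Prod.fst_add, Prod.snd_add, add_mul, mul_add, star_add', re_add]; ring

theorem metricForm_smul (w : Octonion × Octonion) (r : ℝ) (s t : Octonion × Octonion) :
    metricForm w (r • s) t = r * metricForm w s t := by
  simp only [metricForm, ip, Prod.smul_fst, Prod.smul_snd, star_smul', smul_mul_assoc,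
    mul_smul_comm, re_smul]; ring

theorem le_metricForm_self (w s : Octonion × Octonion) :
    (‖s.1‖ ^ 2 + ‖s.2‖ ^ 2) / (1 + ‖w.1‖ ^ 2 + ‖w.2‖ ^ 2) ^ 2 ≤ metricForm w s s := by
  have h := re_mul_le (w.1 * star w.2) (s.2 * star s.1)
  simp only [norm_mul', norm_star'] at h
  simp only [metricForm_self, normSq_eq]
  gcongr
  nlinarith [sq_nonneg (‖s.1‖ * ‖w.2‖ - ‖s.2‖ * ‖w.1‖)]

/-- `metricForm w` as a continuous bilinear form. -/
def metricFormL (w : Octonion × Octonion) :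
    Octonion × Octonion →L[ℝ] Octonion × Octonion →L[ℝ] ℝ :=
  (LinearMap.mk₂ ℝ (metricForm w) (metricForm_add w) (metricForm_smul w)
    (fun s t t' => by
      rw [metricForm_comm, metricForm_add, metricForm_comm w t, metricForm_comm w t'])
    (fun r s t => by
      rw [metricForm_comm, metricForm_smul, metricForm_comm w t, smul_eq_mul])).toContinuousBilinearMap

theorem metricForm_pos (w s : Octonion × Octonion) (hs : s ≠ 0) : 0 < metricForm w s s := by
  refine lt_of_lt_of_le ?_ (le_metricForm_self w s)
  have h : s.1 ≠ 0 ∨ s.2 ≠ 0 := by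
    by_contra! h
    exact hs (Prod.ext h.1 h.2)
  have : 0 < ‖s.1‖ ^ 2 + ‖s.2‖ ^ 2 := by
    rcases h with h | h
    · have := norm_pos_iff.2 h; positivity
    · have := norm_pos_iff.2 h; positivity
  positivity

theorem isVonNBounded_metricForm (w : Octonion × Octonion) :
    Bornology.IsVonNBounded ℝ {s : Octonion × Octonion | metricForm w s s < 1} := by
  rw [NormedSpace.isVonNBounded_iff, isBounded_iff_forall_norm_le]
  refine ⟨1 + ‖w.1‖ ^ 2 + ‖w.2‖ ^ 2, fun s hs => ?_⟩
  have h := (le_metricForm_self w s).trans (le_of_lt hs)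
  rw [div_le_one (by positivity)] at h
  rw [Prod.norm_def, max_le_iff]
  constructor <;> refine le_of_sq_le_sq ?_ (by positivity) <;>
    nlinarith [sq_nonneg ‖s.1‖, sq_nonneg ‖s.2‖]

open scoped Manifold

/-- The Riemannian metric of `𝕆P²`: in the charts it is given by `metricForm`. The expression is the
same in all three charts, and the transition maps preserve it, so that it does not matter which of
the charts around `P` is used; here it is the preferred one. -/
def metric : Bundle.RiemannianMetric
    (fun P : OP2 => TangentSpace 𝓘(ℝ, Octonion × Octonion) P) where
  inner P := metricFormL (chartAt (Octonion × Octonion) P P)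
  symm _ s t := metricForm_comm _ s t
  pos _ s hs := metricForm_pos _ s hs
  continuousAt P :=
    (((metricFormL (chartAt (Octonion × Octonion) P P)).continuous).clm_apply
      continuous_id).continuousAt
  isVonNBounded _ := isVonNBounded_metricForm _

/-- The point `P₀ = [1,0,0]`. -/
def P₀ : OP2 := point 0 (0, 0)

theorem chartAt_P₀ : chartAt (Octonion × Octonion) P₀ = chart 0 := by
  change chart (chartIndex P₀) = chart 0
  rw [chartIndex, if_pos (by exact point_mem 0 _)]

/-- The coordinate basis of `𝕆 × 𝕆`: first the `(x_i, 0)`, then the `(0, x_i)`. -/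
def frame : Module.Basis (Fin 8 ⊕ Fin 8) ℝ (Octonion × Octonion) := x.prod x

/-- The tangent vector at `P₀` that corresponds to the pair `(a, b) = (∑ aᵢ xᵢ, ∑ bᵢ xᵢ)`, that is
`∑ aᵢ eᵢ + ∑ bᵢ fᵢ`, in the chart `[1,u,v] ↦ (u,v)`. -/
def tangent (a b : Octonion) : TangentSpace 𝓘(ℝ, Octonion × Octonion) P₀ :=
  ((a, b) : Octonion × Octonion)

/-- The coordinate vector `e_i = ∂_i` at `P₀`. -/
def e (i : Fin 8) : TangentSpace 𝓘(ℝ, Octonion × Octonion) P₀ := frame (Sum.inl i)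

/-- The coordinate vector `f_i = ∂_{i+8}` at `P₀`. -/
def f (i : Fin 8) : TangentSpace 𝓘(ℝ, Octonion × Octonion) P₀ := frame (Sum.inr i)

theorem tangent_eq_sum (a b : Octonion) :
    tangent a b = ∑ i, x.repr a i • e i + ∑ i, x.repr b i • f i := by
  have h := frame.sum_repr ((a, b) : Octonion × Octonion)
  rw [Fintype.sum_sum_type] at h
  simp only [frame, Module.Basis.prod_repr_inl, Module.Basis.prod_repr_inr] at h
  exact h.symm

/-- The Riemann curvature tensor of `𝕆P²` at `P₀`. -/
def R (X Y Z W : TangentSpace 𝓘(ℝ, Octonion × Octonion) P₀) : ℝ :=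
  CoordinateCurvature.riemannTensor frame metric P₀ X Y Z W

end OP2

end

/-! ### Derivatives of products and quotients -/

section Calculus

variable {E : Type*} [NormedAddCommGroup E] [NormedSpace ℝ E]

/-! In the chart around `P₀` every metric coefficient has the form (c + N(w,w)) / (1 + D(w,w))² with
N and D bilinear, D the Euclidean form and c its value on the two frame vectors (`metricForm_eq`).
Hence at w = 0 the Gram matrix is the identity and all first derivatives vanish. The Christoffel
symbols vanish there too, and the curvature is half an alternating sum of second derivatives of the
metric (`riemannLow_eq`); these are the second derivatives of N - 2cD.

Inserting them gives a sum of products ⟨a,c⟩⟨b,d⟩ and of terms ⟨a b̄, c d̄⟩. The pure terms, with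
factor 4, come from -2cD alone. The mixed terms are brought to the shape `curvatureForm` by a single
fact about the octonions, the polarized composition law `ip_mul_star_add_ip_mul_star`.

Both sides are multilinear, so agreement on the frame gives the component-free formula `R_tangent`;
the listed components are its values at the pairs (x_i, 0) and (0, x_i). One point about charts
remains: the metric is defined through the preferred chart at each point, and `metricInChart_P₀`
holds because that chart is the same on all of `U 0`. -/

/-- The product of a function that is continuous at a point with one that is differentiable and
vanishes there is differentiable. -/
theorem HasFDerivAt.continuousAt_mul_of_eq_zero {h k : E → ℝ} {k' : E →L[ℝ] ℝ} {y : E}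
    (hk : HasFDerivAt k k' y) (hk0 : k y = 0) (hh : ContinuousAt h y) :
    HasFDerivAt (fun z => h z * k z) (h y • k') y := by
  rw [hasFDerivAt_iff_isLittleO] at hk ⊢
  -- As k y = 0, the remainder h(z)k(z) - h(y)k'(z-y) splits into h(z)(k(z) - k(y) - k'(z-y)) and
  -- (h(z) - h(y))k'(z-y). In the first the bounded factor h multiplies an o(z-y), in the second an
  -- o(1) multiplies an O(z-y).
  have h1 : (fun z => h z * (k z - k y - k' (z - y))) =o[nhds y] fun z => z - y := by
    have := (hh.isBigO_one ℝ).mul_isLittleO hk.norm_right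
    simpa using this
  have h2 : (fun z => (h z - h y) * k' (z - y)) =o[nhds y] fun z => z - y := by
    have ha : (fun z => h z - h y) =o[nhds y] fun _ => (1 : ℝ) := by
      rw [Asymptotics.isLittleO_one_iff, tendsto_sub_nhds_zero_iff]
      exact hh
    have := ha.mul_isBigO ((k'.isBigO_sub (nhds y) y).norm_right)
    simpa using this
  refine (h1.add h2).congr_left fun z => ?_
  simp only [hk0, smul_apply, smul_eq_mul]
  ring

/-- The derivative of `(c + N(y,y)) / (1 + D(y,y))²` for bilinear forms `N` and `D ≥ 0`. -/
theorem hasFDerivAt_quadratic_div_sq (c : ℝ) (N D : E →L[ℝ] E →L[ℝ] ℝ) (hD : ∀ y, 0 ≤ D y y)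
    (y : E) :
    HasFDerivAt (fun y => (c + N y y) / (1 + D y y) ^ 2)
      (((1 + D y y) ^ 2)⁻¹ • (N y + N.flip y) -
        ((c + N y y) * 2 * ((1 + D y y) ^ 3)⁻¹) • (D y + D.flip y)) y := by
  have hd : 1 + D y y ≠ 0 := by have := hD y; positivity
  have hq : ∀ B : E →L[ℝ] E →L[ℝ] ℝ, HasFDerivAt (fun y => B y y) (B y + B.flip y) y := by
    intro B
    refine (B.hasFDerivAt.clm_apply (hasFDerivAt_id y)).congr_fderiv ?_
    ext a; simp
  have hN := (hq N).const_add c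
  have hDd := (hasDerivAt_inv (pow_ne_zero 2 hd)).comp_hasFDerivAt y (((hq D).const_add 1).pow 2)
  refine ((hN.mul hDd).congr_fderiv ?_).congr_of_eventuallyEq (.of_forall fun z => ?_)
  · ext a
    simp
    field_simp
    ring
  · simp [div_eq_mul_inv]

theorem fderiv_quadratic_div_sq (c : ℝ) (N D : E →L[ℝ] E →L[ℝ] ℝ) (hD : ∀ y, 0 ≤ D y y)
    (a y : E) :
    fderiv ℝ (fun y => (c + N y y) / (1 + D y y) ^ 2) y a =
      ((1 + D y y) ^ 2)⁻¹ * (N y a + N a y) -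
        ((c + N y y) * 2 * ((1 + D y y) ^ 3)⁻¹) * (D y a + D a y) := by
  rw [(hasFDerivAt_quadratic_div_sq c N D hD y).fderiv]; simp; ring

/-- The second derivative of `(c + N(y,y)) / (1 + D(y,y))²` at the origin. -/
theorem hasFDerivAt_fderiv_quadratic_div_sq (c : ℝ) (N D : E →L[ℝ] E →L[ℝ] ℝ)
    (hD : ∀ y, 0 ≤ D y y) (a : E) :
    HasFDerivAt (fun y => fderiv ℝ (fun y => (c + N y y) / (1 + D y y) ^ 2) y a)
      (N a + N.flip a - (2 * c) • (D a + D.flip a)) 0 := by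
  simp only [fderiv_quadratic_div_sq c N D hD]
  have hd : ∀ y, 1 + D y y ≠ 0 := fun y => by have := hD y; positivity
  have hl : ∀ B : E →L[ℝ] E →L[ℝ] ℝ,
      HasFDerivAt (fun y => B y a + B a y) (B a + B.flip a) 0 := fun B => by
    refine ((B a + B.flip a).hasFDerivAt (x := 0)).congr_of_eventuallyEq
      (.of_forall fun z => ?_)
    simp [add_comm]
  have hcN : Continuous fun y => N y y := by fun_prop
  have hcD : Continuous fun y => D y y := by fun_prop
  -- Each summand of the first derivative is a scalar factor times y ↦ B(y,a) + B(a,y), which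
  -- vanishes at 0. So the factors need only be continuous, and only their values 1 and 2c at 0
  -- enter the second derivative.
  have h1 : ContinuousAt (fun y => ((1 + D y y) ^ 2)⁻¹) 0 :=
    ((continuous_const.add hcD).pow 2).continuousAt.inv₀ (pow_ne_zero 2 (hd 0))
  have h2 : ContinuousAt (fun y => (c + N y y) * 2 * ((1 + D y y) ^ 3)⁻¹) 0 :=
    (((continuous_const.add hcN).mul continuous_const).continuousAt).mul
      (((continuous_const.add hcD).pow 3).continuousAt.inv₀ (pow_ne_zero 3 (hd 0)))
  refine (((hl N).continuousAt_mul_of_eq_zero (by simp) h1).sub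
    ((hl D).continuousAt_mul_of_eq_zero (by simp) h2)).congr_fderiv ?_
  ext b
  simp
  ring

end Calculus

/-! ### Curvature at a point where the metric is standard to first order -/

namespace CoordinateCurvature

variable {E : Type*} [NormedAddCommGroup E] [NormedSpace ℝ E]
  {ι : Type*} [Fintype ι] [DecidableEq ι]

theorem christoffel_eq_zero {b : Module.Basis ι ℝ E} {G : E → E → E → ℝ} {y : E}
    (h0 : ∀ α β γ, partialDeriv b γ (fun z => gram b G z α β) y = 0) (δ α β : ι) :
    christoffel b G δ α β y = 0 := by
  simp [christoffel, h0]

/-- The inverse is the adjugate divided by the determinant; both are polynomial in the entries, and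
the determinant is 1 at y. -/
theorem continuousAt_gram_inv {b : Module.Basis ι ℝ E} {G : E → E → E → ℝ} {y : E}
    (h1 : gram b G y = 1) (hc : ∀ α β, ContinuousAt (fun z => gram b G z α β) y) (δ ε : ι) :
    ContinuousAt (fun z => (gram b G z)⁻¹ δ ε) y := by
  have hg : ContinuousAt (gram b G) y :=
    continuousAt_pi.2 fun α => continuousAt_pi.2 fun β => hc α β
  have hdet : ContinuousAt (fun z => (gram b G z).det) y :=
    ContinuousAt.comp (g := Matrix.det) continuous_id.matrix_det.continuousAt hg
  have hadj : ContinuousAt (fun z => (gram b G z).adjugate) y :=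
    ContinuousAt.comp (g := Matrix.adjugate) continuous_id.matrix_adjugate.continuousAt hg
  have hadj' : ContinuousAt (fun z => (gram b G z).adjugate δ ε) y :=
    continuousAt_pi.1 (continuousAt_pi.1 hadj δ) ε
  have h := (hdet.inv₀ (by rw [h1, Matrix.det_one]; exact one_ne_zero)).mul hadj'
  refine h.congr (.of_forall fun z => ?_)
  simp [Matrix.inv_def, Ring.inverse_eq_inv']

/-- The bracket of first derivatives vanishes at y, so the inverse Gram matrix has to be continuous
there but is never differentiated. Its value at y is the identity, which leaves only ε = δ in the
sum. -/
theorem hasFDerivAt_christoffel {b : Module.Basis ι ℝ E} {G : E → E → E → ℝ} {y : E}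
    {H : ι → ι → ι → E →L[ℝ] ℝ}
    (h1 : gram b G y = 1) (hc : ∀ α β, ContinuousAt (fun z => gram b G z α β) y)
    (h0 : ∀ α β γ, partialDeriv b γ (fun z => gram b G z α β) y = 0)
    (hH : ∀ α β γ, HasFDerivAt (partialDeriv b γ fun z => gram b G z α β) (H α β γ) y)
    (δ α β : ι) :
    HasFDerivAt (christoffel b G δ α β) ((1 / 2 : ℝ) • (H β δ α + H α δ β - H α β δ)) y := by
  have hterm : ∀ ε, HasFDerivAt (fun z => (gram b G z)⁻¹ δ ε *
      (partialDeriv b α (fun z => gram b G z β ε) z + partialDeriv b β (fun z => gram b G z α ε) z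
        - partialDeriv b ε (fun z => gram b G z α β) z))
      ((gram b G y)⁻¹ δ ε • (H β ε α + H α ε β - H α β ε)) y := fun ε =>
    (((hH β ε α).add (hH α ε β)).sub (hH α β ε)).continuousAt_mul_of_eq_zero
      (by simp [h0]) (continuousAt_gram_inv h1 hc δ ε)
  refine ((HasFDerivAt.fun_sum fun ε _ => hterm ε).const_mul (1 / 2 : ℝ)).congr_fderiv ?_
  simp [h1, Matrix.one_apply]

/-- The curvature at a point where the metric is standard to first order is given by the second
derivatives of the metric. -/
theorem riemannLow_eq {b : Module.Basis ι ℝ E} {G : E → E → E → ℝ} {y : E}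
    {H : ι → ι → ι → E →L[ℝ] ℝ}
    (h1 : gram b G y = 1) (hc : ∀ α β, ContinuousAt (fun z => gram b G z α β) y)
    (h0 : ∀ α β γ, partialDeriv b γ (fun z => gram b G z α β) y = 0)
    (hH : ∀ α β γ, HasFDerivAt (partialDeriv b γ fun z => gram b G z α β) (H α β γ) y)
    (α β γ δ : ι) :
    riemannLow b G α β γ δ y =
      1 / 2 * (H γ δ α (b β) + H α δ γ (b β) - H α γ δ (b β)
        - (H γ δ β (b α) + H β δ γ (b α) - H β γ δ (b α))) := by
  have hd : ∀ δ α β ε, partialDeriv b ε (christoffel b G δ α β) y =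
      1 / 2 * (H β δ α (b ε) + H α δ β (b ε) - H α β δ (b ε)) := fun δ α β ε => by
    rw [partialDeriv, (hasFDerivAt_christoffel h1 hc h0 hH δ α β).fderiv]; simp
  -- The products of Christoffel symbols vanish at y, and lowering the index with the identity
  -- matrix changes nothing; only the two derivatives of Christoffel symbols remain.
  simp only [riemannLow, riemannUp, h1, Matrix.one_apply, mul_ite, mul_one, mul_zero,
    Finset.sum_ite_eq', Finset.mem_univ, if_true, christoffel_eq_zero h0, hd]
  simp
  ring

end CoordinateCurvature

/-! ### The curvature of the octonionic projective plane -/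

namespace Octonion

/-! ### Bilinearity of the inner product and the composition law -/

theorem ip_comm (a b : Octonion) : ip a b = ip b a := by
  rw [ip_eq_inner, ip_eq_inner, real_inner_comm]

theorem ip_add_left (a b c : Octonion) : ip (a + b) c = ip a c + ip b c := by
  simp only [ip_eq_inner, inner_add_left]

theorem ip_add_right (a b c : Octonion) : ip a (b + c) = ip a b + ip a c := by
  simp only [ip_eq_inner, inner_add_right]

theorem ip_sub_left (a b c : Octonion) : ip (a - b) c = ip a c - ip b c := by
  simp only [ip_eq_inner, inner_sub_left]

theorem ip_sub_right (a b c : Octonion) : ip a (b - c) = ip a b - ip a c := by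
  simp only [ip_eq_inner, inner_sub_right]

theorem ip_smul_left (r : ℝ) (a b : Octonion) : ip (r • a) b = r * ip a b := by
  simp only [ip_eq_inner, real_inner_smul_left]

theorem ip_smul_right (r : ℝ) (a b : Octonion) : ip a (r • b) = r * ip a b := by
  simp only [ip_eq_inner, real_inner_smul_right]

theorem ip_zero_left (a : Octonion) : ip 0 a = 0 := by simp [ip_eq_inner]

theorem ip_zero_right (a : Octonion) : ip a 0 = 0 := by simp [ip_eq_inner]

theorem ip_neg_left (a b : Octonion) : ip (-a) b = -ip a b := by simp [ip_eq_inner]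

theorem ip_neg_right (a b : Octonion) : ip a (-b) = -ip a b := by simp [ip_eq_inner]

theorem star_zero' : star (0 : Octonion) = 0 := starL.map_zero

theorem ip_star_star (a b : Octonion) : ip (star a) (star b) = ip a b := by
  simp [ip_eq]

/-- `<a b̄, c d̄> = <b ā, d c̄>`. -/
theorem ip_mul_star_swap (a b c d : Octonion) :
    ip (a * star b) (c * star d) = ip (b * star a) (d * star c) := by
  rw [← ip_star_star, star_mul', star_mul', star_star', star_star']

/-- Turns the cross term Re[(u v̄)(dv dū)] of the metric into ⟨u v̄, du d̄v⟩, a form that is visibly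
bilinear in (u, v) and to which the composition law applies. -/
theorem re_mul_mul_star (a b c : Octonion) : re (a * (b * star c)) = ip a (c * star b) := by
  rw [ip, star_mul', star_star']

/-- The composition property `|a b|² = |a|² |b|²`, polarized in both factors. -/
theorem ip_mul_star_add_ip_mul_star (a b c d : Octonion) :
    ip (a * star b) (c * star d) + ip (a * star d) (c * star b) = 2 * ip a c * ip b d := by
  have h : ∀ a b, ip (a * star b) (a * star b) = ip a a * ip b b := fun a b => by
    have := normSq_mul a (star b)
    simpa only [normSq, ip_star_star] using this
  -- Second difference of |a b̄|² = |a|²|b|² in both factors: `h1` minus `h2`, …, `h5` plus `e1`, …,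
  -- `e4` leaves twice the claim.
  have h1 := h (a + c) (b + d)
  have h2 := h (a + c) b
  have h3 := h (a + c) d
  have h4 := h a (b + d)
  have h5 := h c (b + d)
  have e1 := h a b
  have e2 := h a d
  have e3 := h c b
  have e4 := h c d
  simp only [star_add', add_mul, mul_add, ip_add_left, ip_add_right] at h1 h2 h3 h4 h5
  simp only [ip_comm c a, ip_comm d b, ip_comm (c * star b) (a * star b),
    ip_comm (c * star d) (a * star d), ip_comm (c * star d) (a * star b),
    ip_comm (c * star b) (a * star d), ip_comm (a * star d) (a * star b),
    ip_comm (c * star d) (c * star b)] at h1 h2 h3 h4 h5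
  linarith

theorem ip_x (i j : Fin 8) : ip (x i) (x j) = if i = j then 1 else 0 := by
  have h : ∀ a b : Octonion, ip a b = ∑ k, x.repr a k * x.repr b k := fun a b => by
    rw [ip_eq, Fin.sum_univ_eight]; rfl
  rw [h]
  simp [Finsupp.single_apply]

end Octonion

/-! ### The metric in the chart around `P₀` -/

namespace OP2

open Octonion CoordinateCurvature
open scoped Manifold

/-- `chartIndex` tests `U 0` first, so the preferred chart does not change anywhere on the image of
`point 0`. -/
theorem chartAt_eq_of_mem {P : OP2} (h : P ∈ U 0) :
    chartAt (Octonion × Octonion) P = chart 0 := by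
  change chart (chartIndex P) = chart 0
  rw [chartIndex, if_pos h]

/-- The tangent space at `point 0 y` is identified with 𝕆 × 𝕆 through `chart 0`, whose inverse is
`point 0`; read in that chart the map is the identity. -/
theorem mfderiv_point_zero (y : Octonion × Octonion) :
    mfderiv 𝓘(ℝ, Octonion × Octonion) 𝓘(ℝ, Octonion × Octonion) (point 0) y =
      ContinuousLinearMap.id ℝ (Octonion × Octonion) := by
  have hw : writtenInExtChartAt 𝓘(ℝ, Octonion × Octonion) 𝓘(ℝ, Octonion × Octonion) y (point 0)
      = id := by
    funext z
    have := chartAt_eq_of_mem (point_mem 0 y)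
    simp only [writtenInExtChartAt, extChartAt, this]
    simp
    exact coord_point 0 z
  have hd : HasMFDerivAt 𝓘(ℝ, Octonion × Octonion) 𝓘(ℝ, Octonion × Octonion) (point 0) y
      (ContinuousLinearMap.id ℝ (Octonion × Octonion)) := by
    refine ⟨(continuous_point 0).continuousAt, ?_⟩
    rw [hw]
    exact hasFDerivWithinAt_id _ _
  exact hd.mfderiv

/-- In the chart `[1,u,v] ↦ (u,v)` the metric is given by `metricForm`. -/
theorem metricInChart_P₀ : metricInChart metric P₀ = metricForm := by
  funext y v w
  have h : ∀ v, mfderiv 𝓘(ℝ, Octonion × Octonion) 𝓘(ℝ, Octonion × Octonion) (point 0) y v = v :=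
    fun v => by rw [mfderiv_point_zero]; rfl
  have hp : chartAt (Octonion × Octonion) (point 0 y) (point 0 y) = y := by
    rw [chartAt_eq_of_mem (point_mem 0 y)]; exact coord_point 0 y
  rw [metricInChart, chartAt_P₀]
  change metricForm (chartAt (Octonion × Octonion) (point 0 y) (point 0 y))
    (mfderiv 𝓘(ℝ, Octonion × Octonion) 𝓘(ℝ, Octonion × Octonion) (point 0) y v)
    (mfderiv 𝓘(ℝ, Octonion × Octonion) 𝓘(ℝ, Octonion × Octonion) (point 0) y w) = _
  exact congr (congr (congrArg metricForm hp) (h v)) (h w)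

theorem chartAt_P₀_P₀ : chartAt (Octonion × Octonion) P₀ P₀ = 0 := by
  rw [chartAt_P₀]; exact coord_point 0 _

/-! ### The metric coefficients as quotients of quadratic polynomials -/

/-- The quadratic part of the numerator of `metricForm`, as a bilinear form in the base point. -/
noncomputable def metricNumerator (s t : Octonion × Octonion) :
    Octonion × Octonion →L[ℝ] Octonion × Octonion →L[ℝ] ℝ :=
  (LinearMap.mk₂ ℝ
    (fun w z : Octonion × Octonion => ip s.1 t.1 * ip w.2 z.2 + ip s.2 t.2 * ip w.1 z.1
      - (ip (w.1 * star z.2) (t.1 * star s.2) + ip (w.1 * star z.2) (s.1 * star t.2)))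
    (fun w w' z => by simp only [Prod.fst_add, Prod.snd_add, add_mul, ip_add_left]; ring)
    (fun r w z => by
      simp only [Prod.smul_fst, Prod.smul_snd, smul_mul_assoc, ip_smul_left, smul_eq_mul]; ring)
    (fun w z z' => by
      simp only [Prod.fst_add, Prod.snd_add, star_add', mul_add, ip_add_left, ip_add_right]; ring)
    (fun r w z => by
      simp only [Prod.smul_fst, Prod.smul_snd, star_smul', mul_smul_comm, ip_smul_left,
        ip_smul_right, smul_eq_mul]; ring)).toContinuousBilinearMap

theorem metricNumerator_apply (s t w z : Octonion × Octonion) : metricNumerator s t w z =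
    ip s.1 t.1 * ip w.2 z.2 + ip s.2 t.2 * ip w.1 z.1
      - (ip (w.1 * star z.2) (t.1 * star s.2) + ip (w.1 * star z.2) (s.1 * star t.2)) := rfl

/-- The Euclidean inner product of `𝕆 × 𝕆`. -/
noncomputable def pairing : Octonion × Octonion →L[ℝ] Octonion × Octonion →L[ℝ] ℝ :=
  (LinearMap.mk₂ ℝ (fun w z : Octonion × Octonion => ip w.1 z.1 + ip w.2 z.2)
    (fun w w' z => by simp only [Prod.fst_add, Prod.snd_add, ip_add_left]; ring)
    (fun r w z => by simp only [Prod.smul_fst, Prod.smul_snd, ip_smul_left, smul_eq_mul]; ring)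
    (fun w z z' => by simp only [Prod.fst_add, Prod.snd_add, ip_add_right]; ring)
    (fun r w z => by
      simp only [Prod.smul_fst, Prod.smul_snd, ip_smul_right, smul_eq_mul]
      ring)).toContinuousBilinearMap

theorem pairing_apply (w z : Octonion × Octonion) :
    pairing w z = ip w.1 z.1 + ip w.2 z.2 := rfl

theorem pairing_self_nonneg (w : Octonion × Octonion) : 0 ≤ pairing w w := by
  rw [pairing_apply, ip_self, ip_self]; positivity

theorem metricForm_eq (s t w : Octonion × Octonion) : metricForm w s t =
    (pairing s t + metricNumerator s t w w) / (1 + pairing w w) ^ 2 := by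
  simp only [metricForm, pairing_apply, metricNumerator_apply, normSq, re_mul_mul_star]
  ring

theorem pairing_frame (α β : Fin 8 ⊕ Fin 8) :
    pairing (frame α) (frame β) = if α = β then 1 else 0 := by
  rcases α with i | i <;> rcases β with j | j <;>
    simp [pairing_apply, frame, ip_x, ip_zero_left, ip_zero_right]

/-! ### The curvature components at `P₀` -/

/-- The curvature form of the component-free formula. -/
noncomputable def curvatureForm (X Y Z W : Octonion × Octonion) : ℝ :=
  4 * ip X.1 Z.1 * ip Y.1 W.1 - 4 * ip Y.1 Z.1 * ip X.1 W.1
  + 4 * ip X.2 Z.2 * ip Y.2 W.2 - 4 * ip Y.2 Z.2 * ip X.2 W.2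
  - ip (Z.1 * star Y.2) (W.1 * star X.2) + ip (Z.1 * star X.2) (W.1 * star Y.2)
  - ip (Y.1 * star Z.2) (X.1 * star W.2) + ip (X.1 * star Z.2) (Y.1 * star W.2)
  - ip (X.1 * star Y.2 - Y.1 * star X.2) (W.1 * star Z.2 - Z.1 * star W.2)

theorem riemannLow_metricForm (α β γ δ : Fin 8 ⊕ Fin 8) :
    riemannLow frame metricForm α β γ δ 0 =
      curvatureForm (frame α) (frame β) (frame γ) (frame δ) := by
  have hg : ∀ α β, (fun z => gram frame metricForm z α β) = fun z =>
      (pairing (frame α) (frame β) + metricNumerator (frame α) (frame β) z z) /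
        (1 + pairing z z) ^ 2 := fun α β => funext fun z => metricForm_eq _ _ z
  have h1 : gram frame metricForm 0 = 1 := by
    ext α β
    rw [congrFun (hg α β) 0, pairing_frame, Matrix.one_apply]
    simp
  rw [riemannLow_eq h1
    -- The second derivative at 0 of N - 2cD, the quadratic part of the quotient, with one direction
    -- set to frame vector γ.
    (H := fun α β γ => metricNumerator (frame α) (frame β) (frame γ)
      + (metricNumerator (frame α) (frame β)).flip (frame γ)
      - (2 * pairing (frame α) (frame β)) • (pairing (frame γ) + pairing.flip (frame γ)))]
  -- The remaining identity holds for arbitrary vectors; orthonormality of the frame was needed only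
  -- for `h1`.
  · generalize frame α = X
    generalize frame β = Y
    generalize frame γ = Z
    generalize frame δ = W
    obtain ⟨a, b⟩ := X
    obtain ⟨c, d⟩ := Y
    obtain ⟨e, f⟩ := Z
    obtain ⟨g, h⟩ := W
    simp only [sub_apply, add_apply,
      ContinuousLinearMap.flip_apply, smul_apply, smul_eq_mul,
      pairing_apply, metricNumerator_apply, curvatureForm, ip_sub_left, ip_sub_right]
    -- Each symmetric inner product gets one fixed order, so that `linarith` sees equal terms as the
    -- same atom.
    simp only [ip_comm c a, ip_comm (c * star f) (a * star h), ip_comm (c * star h) (a * star f),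
      ip_comm e a, ip_comm h d, ip_comm (e * star d) (a * star h), ip_comm g a, ip_comm f d,
      ip_comm (g * star d) (a * star f), ip_comm e c, ip_comm h b,
      ip_comm (e * star b) (c * star h), ip_comm g c, ip_comm f b,
      ip_comm (g * star b) (c * star f), ip_comm d b, ip_comm (g * star b) (e * star d),
      ip_comm (g * star d) (e * star b)]
    -- One instance of the composition law for each choice of two among the four vectors: those two
    -- contribute their first components, the other two their second components.
    linarith [ip_mul_star_add_ip_mul_star a f c h,
      ip_mul_star_add_ip_mul_star a d e h,
      ip_mul_star_add_ip_mul_star a d g f,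
      ip_mul_star_add_ip_mul_star c b e h,
      ip_mul_star_add_ip_mul_star c b g f,
      ip_mul_star_add_ip_mul_star e b g d]
  · intro α β
    rw [hg]
    exact (hasFDerivAt_quadratic_div_sq _ _ _ pairing_self_nonneg 0).continuousAt
  · intro α β γ
    rw [hg, partialDeriv, fderiv_quadratic_div_sq _ _ _ pairing_self_nonneg]
    simp
  · intro α β γ
    rw [hg]
    exact hasFDerivAt_fderiv_quadratic_div_sq _ _ _ pairing_self_nonneg _

/-! ### From frame components to arbitrary tangent vectors -/

/-- Expansion of a linear form in a basis. -/
theorem sum_repr_mul {E ι : Type*} [AddCommGroup E] [Module ℝ E] [Fintype ι]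
    (b : Module.Basis ι ℝ E) {φ : E → ℝ} (hφ : IsLinearMap ℝ φ) (X : E) :
    ∑ α, b.repr X α * φ (b α) = φ X := by
  conv_rhs => rw [← b.sum_repr X]
  have := map_sum (hφ.mk' φ) (fun α => b.repr X α • b α) Finset.univ
  simpa [hφ.map_smul] using this.symm

/-- Linearity in each of the four slots is what collapses the fourfold sum over components in the
definition of the curvature tensor. -/
theorem isLinearMap_curvatureForm₁ (Y Z W : Octonion × Octonion) :
    IsLinearMap ℝ fun X => curvatureForm X Y Z W := by
  constructor <;> intros <;>
  simp only [curvatureForm, Prod.fst_add, Prod.snd_add, Prod.smul_fst, Prod.smul_snd, star_add',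
    star_smul', add_mul, mul_add, smul_mul_assoc, mul_smul_comm, ip_sub_left, ip_sub_right,
    ip_add_left, ip_add_right, ip_smul_left, ip_smul_right, smul_eq_mul] <;> ring

theorem isLinearMap_curvatureForm₂ (X Z W : Octonion × Octonion) :
    IsLinearMap ℝ fun Y => curvatureForm X Y Z W := by
  constructor <;> intros <;>
  simp only [curvatureForm, Prod.fst_add, Prod.snd_add, Prod.smul_fst, Prod.smul_snd, star_add',
    star_smul', add_mul, mul_add, smul_mul_assoc, mul_smul_comm, ip_sub_left, ip_sub_right,
    ip_add_left, ip_add_right, ip_smul_left, ip_smul_right, smul_eq_mul] <;> ring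

theorem isLinearMap_curvatureForm₃ (X Y W : Octonion × Octonion) :
    IsLinearMap ℝ fun Z => curvatureForm X Y Z W := by
  constructor <;> intros <;>
  simp only [curvatureForm, Prod.fst_add, Prod.snd_add, Prod.smul_fst, Prod.smul_snd, star_add',
    star_smul', add_mul, mul_add, smul_mul_assoc, mul_smul_comm, ip_sub_left, ip_sub_right,
    ip_add_left, ip_add_right, ip_smul_left, ip_smul_right, smul_eq_mul] <;> ring

theorem isLinearMap_curvatureForm₄ (X Y Z : Octonion × Octonion) :
    IsLinearMap ℝ fun W => curvatureForm X Y Z W := by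
  constructor <;> intros <;>
  simp only [curvatureForm, Prod.fst_add, Prod.snd_add, Prod.smul_fst, Prod.smul_snd, star_add',
    star_smul', add_mul, mul_add, smul_mul_assoc, mul_smul_comm, ip_sub_left, ip_sub_right,
    ip_add_right, ip_smul_right, smul_eq_mul] <;> ring

theorem R_eq_curvatureForm (X Y Z W : Octonion × Octonion) :
    R X Y Z W = curvatureForm X Y Z W := by
  change ∑ α, ∑ β, ∑ γ, ∑ δ,
    frame.repr X α * frame.repr Y β * frame.repr Z γ * frame.repr W δ *
      riemannLow frame (metricInChart metric P₀) α β γ δ (chartAt (Octonion × Octonion) P₀ P₀) = _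
  rw [metricInChart_P₀, chartAt_P₀_P₀]
  simp only [riemannLow_metricForm, mul_assoc, ← Finset.mul_sum]
  -- The sums collapse from the innermost outwards: each evaluation replaces one frame vector by the
  -- full argument before the next sum is treated.
  simp only [sum_repr_mul frame (isLinearMap_curvatureForm₄ _ _ _),
    sum_repr_mul frame (isLinearMap_curvatureForm₃ _ _ _),
    sum_repr_mul frame (isLinearMap_curvatureForm₂ _ _ _),
    sum_repr_mul frame (isLinearMap_curvatureForm₁ _ _ _)]

/-! ### Evaluation of the formula on the frame -/

theorem e_eq_tangent (i : Fin 8) : e i = tangent (x i) 0 := by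
  simp [e, tangent, frame]; rfl

theorem f_eq_tangent (i : Fin 8) : f i = tangent 0 (x i) := by
  simp [f, tangent, frame]; rfl

theorem R_tangent (a b c d e f g h : Octonion) :
    R (tangent a b) (tangent c d) (tangent e f) (tangent g h) =
      4 * ip a e * ip c g - 4 * ip c e * ip a g + 4 * ip b f * ip d h - 4 * ip d f * ip b h
      - ip (e * star d) (g * star b) + ip (e * star b) (g * star d)
      - ip (c * star f) (a * star h) + ip (a * star f) (c * star h)
      - ip (a * star d - c * star b) (g * star f - e * star h) :=
  R_eq_curvatureForm (a, b) (c, d) (e, f) (g, h)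

end OP2

theorem mainTheorem2 :
    -- (1) and (2): components of types `eeee` and `ffff`
    (∀ i j : Fin 8, i ≠ j →
      OP2.R (OP2.e i) (OP2.e j) (OP2.e i) (OP2.e j) = 4 ∧
      -OP2.R (OP2.e i) (OP2.e j) (OP2.e j) (OP2.e i) = 4 ∧
      OP2.R (OP2.f i) (OP2.f j) (OP2.f i) (OP2.f j) = 4 ∧
      -OP2.R (OP2.f i) (OP2.f j) (OP2.f j) (OP2.f i) = 4) ∧
    -- the other components of these two types vanish
    (∀ i j k l : Fin 8, ¬(i ≠ j ∧ (k = i ∧ l = j ∨ k = j ∧ l = i)) →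
      OP2.R (OP2.e i) (OP2.e j) (OP2.e k) (OP2.e l) = 0 ∧
      OP2.R (OP2.f i) (OP2.f j) (OP2.f k) (OP2.f l) = 0) ∧
    -- (3)
    (∀ i j k l : Fin 8,
      OP2.R (OP2.e i) (OP2.e j) (OP2.f k) (OP2.f l) =
        -Octonion.ip (Octonion.x i * star (Octonion.x l)) (Octonion.x j * star (Octonion.x k))
          + Octonion.ip (Octonion.x j * star (Octonion.x l)) (Octonion.x i * star (Octonion.x k)) ∧
      OP2.R (OP2.f k) (OP2.f l) (OP2.e i) (OP2.e j) =
        -Octonion.ip (Octonion.x i * star (Octonion.x l)) (Octonion.x j * star (Octonion.x k))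
          + Octonion.ip (Octonion.x j * star (Octonion.x l))
              (Octonion.x i * star (Octonion.x k))) ∧
    -- (4)
    (∀ i j k l : Fin 8,
      OP2.R (OP2.e i) (OP2.f j) (OP2.e k) (OP2.f l) =
        Octonion.ip (Octonion.x i * star (Octonion.x j)) (Octonion.x k * star (Octonion.x l)) ∧
      OP2.R (OP2.f i) (OP2.e j) (OP2.f k) (OP2.e l) =
        Octonion.ip (Octonion.x i * star (Octonion.x j)) (Octonion.x k * star (Octonion.x l)) ∧
      OP2.R (OP2.e i) (OP2.f j) (OP2.f l) (OP2.e k) =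
        -Octonion.ip (Octonion.x i * star (Octonion.x j)) (Octonion.x k * star (Octonion.x l)) ∧
      OP2.R (OP2.f i) (OP2.e j) (OP2.e l) (OP2.f k) =
        -Octonion.ip (Octonion.x i * star (Octonion.x j)) (Octonion.x k * star (Octonion.x l))) ∧
    -- components with an odd number of `e`s vanish
    (∀ i j k l : Fin 8,
      OP2.R (OP2.e i) (OP2.e j) (OP2.e k) (OP2.f l) = 0 ∧
      OP2.R (OP2.e i) (OP2.e j) (OP2.f k) (OP2.e l) = 0 ∧
      OP2.R (OP2.e i) (OP2.f j) (OP2.e k) (OP2.e l) = 0 ∧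
      OP2.R (OP2.f i) (OP2.e j) (OP2.e k) (OP2.e l) = 0 ∧
      OP2.R (OP2.f i) (OP2.f j) (OP2.f k) (OP2.e l) = 0 ∧
      OP2.R (OP2.f i) (OP2.f j) (OP2.e k) (OP2.f l) = 0 ∧
      OP2.R (OP2.f i) (OP2.e j) (OP2.f k) (OP2.f l) = 0 ∧
      OP2.R (OP2.e i) (OP2.f j) (OP2.f k) (OP2.f l) = 0) ∧
    -- the component-free formula
    (∀ a b c d e f g h : Octonion,
      OP2.R (OP2.tangent a b) (OP2.tangent c d) (OP2.tangent e f) (OP2.tangent g h) =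
        4 * Octonion.ip a e * Octonion.ip c g - 4 * Octonion.ip c e * Octonion.ip a g
        + 4 * Octonion.ip b f * Octonion.ip d h - 4 * Octonion.ip d f * Octonion.ip b h
        - Octonion.ip (e * star d) (g * star b) + Octonion.ip (e * star b) (g * star d)
        - Octonion.ip (c * star f) (a * star h) + Octonion.ip (a * star f) (c * star h)
        - Octonion.ip (a * star d - c * star b) (g * star f - e * star h)) := by
  open OP2 Octonion in
  refine ⟨fun i j hij => ?_, fun i j k l h => ?_, fun i j k l => ?_, fun i j k l => ?_,
    fun i j k l => ?_, R_tangent⟩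
  · simp [e_eq_tangent, f_eq_tangent, R_tangent, ip_x, ip_zero_right, star_zero',
      hij, hij.symm]
  -- The left product is 1 only for k = i, l = j and the right one only for k = j, l = i. Outside
  -- the excluded cases either both are 0 or i = j, and then they coincide.
  · have hx : ip (x i) (x k) * ip (x j) (x l) = ip (x j) (x k) * ip (x i) (x l) := by
      simp only [ip_x]
      grind
    simp only [e_eq_tangent, f_eq_tangent, R_tangent, ip_zero_right, star_zero',
      mul_zero, zero_mul, sub_zero, add_zero]
    constructor <;> linear_combination 4 * hx
  · simp only [e_eq_tangent, f_eq_tangent, R_tangent, ip_zero_left, ip_zero_right, star_zero',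
      mul_zero, zero_mul, sub_zero, add_zero]
    rw [ip_comm (x j * star (x k)), ip_comm (x j * star (x l))]
    constructor <;> ring
  · simp only [e_eq_tangent, f_eq_tangent, R_tangent, ip_zero_left, ip_zero_right, star_zero',
      mul_zero, zero_mul, sub_zero, zero_sub, add_zero, ip_neg_left, ip_neg_right]
    -- The components starting with `f` come out as ⟨x_j x̄_i, x_l x̄_k⟩; conjugating both entries
    -- gives the stated form.
    rw [ip_mul_star_swap (x j)]
    simp
  -- Every summand of the formula, once its last inner product is expanded, uses an even number of
  -- first components, so an odd number of `e`s puts a zero into each.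
  · simp [e_eq_tangent, f_eq_tangent, R_tangent, ip_zero_left, ip_zero_right, star_zero']
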